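/- Let $T>0$ and let $X=(X_t)_{t\in[0,T]}$ be a regular invertible Gaussian Volterra process on a probability space $(\Omega,\mathcal F,\mathbb P)$, that is, a centered Gaussian process for which the following holds. 1. There are a continuous non-decreasing function $m:[0,T]\to\mathbb R_+$ and a kernel $K\in L^2([0,T]^2,dm\times dm)$ with $K(t,\cdot)\in L^2([0,T],dm)$ for every $t\in[0,T]$ and $$\mathbb E[X_tX_s]=\int_0^{t\wedge s}K(t,u)K(s,u)\,dm(u),\qquad s,t\in[0,T],$$ such that $K(t,s)=0$ for $t<s$ and, for every $s\in(0,T)$, the function $t\mapsto K(t,s)$ is non-decreasing on $[0,T]$, continuous on $[s,T]$ and continuously differentiable on $(s,T)$; moreover $s\mapsto K(s,s)$ is continuously differentiable on $(0,T)$. 2. For every $t\in[0,T]$ there is a measurable function $f$ such that for $dm$-almost every $s\in[0,T]$ the integral below converges absolutely and $$f(s)K(T,s)+\int_s^T\bigl[f(u)-f(s)\bigr]\frac{\partial K}{\partial u}(u,s)\,du=\mathbf 1_{[0,t)}(s).$$ Then $\int_0^T K(s,s)^2\,dm(s)<\infty$, and $X$ has a pathwise quadratic variation on $[0,T]$, which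 is deterministic and equal to $$q^2(t)=\int_0^tK(s,s)^2\,dm(s),\qquad t\in[0,T],$$ in the following sense. Let $0=t^n_0<t^n_1<\dots<t^n_{N_n}=T$, $n\ge 1$, be any sequence of partitions of $[0,T]$ with $\max_k|t^n_k-t^n_{k-1}|\to0$, and put $$V_n(t)=\sum_{k:\,t^n_k\le t}\bigl(X_{t^n_k}-X_{t^n_{k-1}}\bigr)^2 .$$ Then for every $t\in[0,T]$, $V_n(t)\to q^2(t)$ in probability and in $L^p(\mathbb P)$ for every $p\in[1,\infty)$; and there is a subsequence $(n_j)$ such that, almost surely, $V_{n_j}(t)\to q^2(t)$ for all $t\in[0,T]$ simultaneously. -/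

import Mathlib

open MeasureTheory ProbabilityTheory Filter Topology
open scoped ENNReal

noncomputable section

namespace Volterra

/-- The measure `dm` on `[0,T]` attached to a non-decreasing function `m`. Only the values of `m`
on `[0,T]` matter: the half-open interval leaves out the jump `m 0 - m (0-)`, which depends on the
values of `m` to the left of `0`. -/
def clock (T : ℝ) (m : StieltjesFunction ℝ) : Measure ℝ :=
  m.measure.restrict (Set.Ioc 0 T)

/-- The adjoint operator
`K^*[f](s) = f(s) K(T,s) + ∫_s^T (f(t) - f(s)) ∂K/∂t(t,s) dt`. -/
def adjointOp (T : ℝ) (K : ℝ → ℝ → ℝ) (f : ℝ → ℝ) (s : ℝ) : ℝ :=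
  f s * K T s + ∫ t in s..T, (f t - f s) * deriv (fun v => K v s) t

/-- The pair `(m, K)` is a regular invertible Volterra pair on `[0,T]`: `m` is continuous,
non-decreasing and nonnegative, and `K` is a regular invertible Volterra kernel relative to `m`.
The pointwise regularity of `K(·,s)` is asked for `0 < s < T` only: kernels such as that of
fractional Brownian motion are singular at `s = 0`, and `{0}` and `{T}` are `dm`-null. -/
structure IsRegularInvertiblePair (T : ℝ) (m : StieltjesFunction ℝ) (K : ℝ → ℝ → ℝ) : Prop where
  /-- `m` is continuous on `[0,T]` -/
  clock_continuous : ContinuousOn m (Set.Icc 0 T)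
  /-- `m` takes its values in `ℝ₊` -/
  clock_nonneg : 0 ≤ m 0
  /-- Volterra property -/
  volterra : ∀ s ∈ Set.Icc 0 T, ∀ t ∈ Set.Icc 0 T, t < s → K t s = 0
  /-- `K ∈ L²([0,T]², dm × dm)` -/
  memLp : MemLp (fun p : ℝ × ℝ => K p.1 p.2) 2 ((clock T m).prod (clock T m))
  /-- `K` is non-decreasing in the first variable, on the whole of `[0,T]` -/
  monotone : ∀ s ∈ Set.Ioo 0 T, MonotoneOn (fun t => K t s) (Set.Icc 0 T)
  /-- outside the diagonal, `K` is continuously differentiable in the first variable -/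
  contDiff_off_diagonal : ∀ s ∈ Set.Ioo 0 T, ContDiffOn ℝ 1 (fun t => K t s) (Set.Ioo s T)
  /-- `K(·,s)` is continuous up to the diagonal point `t = s` and up to `t = T` -/
  continuous_to_diagonal : ∀ s ∈ Set.Ioo 0 T, ContinuousOn (fun t => K t s) (Set.Icc s T)
  /-- on the diagonal, `K` is continuously differentiable -/
  contDiff_diagonal : ContDiffOn ℝ 1 (fun s => K s s) (Set.Ioo 0 T)
  /-- for each `t ∈ [0,T]` the equation `K^*[f](s) = 1_{[0,t)}(s)` has a solution -/
  invertible : ∀ t ∈ Set.Icc 0 T, ∃ f : ℝ → ℝ, Measurable f ∧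
    ∀ᵐ s ∂(clock T m),
      IntervalIntegrable (fun u => (f u - f s) * deriv (fun v => K v s) u) volume s T ∧
      adjointOp T K f s = (Set.Ico 0 t).indicator 1 s

/-- `X` is, on `[0,T]` and under `P`, a regular invertible Gaussian Volterra process with
function `m` and kernel `K`: a centered Gaussian process with covariance
`R(t,s) = ∫_0^{t ∧ s} K(t,u) K(s,u) dm(u)`. -/
structure IsRegularInvertibleGaussianVolterra {Ω : Type*} [MeasurableSpace Ω] (P : Measure Ω)
    (T : ℝ) (X : ℝ → Ω → ℝ) (m : StieltjesFunction ℝ) (K : ℝ → ℝ → ℝ) : Prop where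
  gaussian : IsGaussianProcess (fun t : Set.Icc (0 : ℝ) T => X t) P
  centered : ∀ t ∈ Set.Icc 0 T, ∫ ω, X t ω ∂P = 0
  pair : IsRegularInvertiblePair T m K
  /-- the integrals that give the variances `R(t,t)` are finite -/
  memLp_section : ∀ t ∈ Set.Icc 0 T, MemLp (fun u => K t u) 2 (clock T m)
  covariance : ∀ t ∈ Set.Icc 0 T, ∀ s ∈ Set.Icc 0 T,
    ∫ ω, X t ω * X s ω ∂P = ∫ u in Set.Ioc 0 (min t s), K t u * K s u ∂m.measure

/-- A partition `0 = t_0 < t_1 < ⋯ < t_N = T` of `[0,T]`. -/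
structure IntervalPartition (T : ℝ) where
  size : ℕ
  pt : Fin (size + 1) → ℝ
  pt_zero : pt 0 = 0
  pt_last : pt (Fin.last size) = T
  strictMono : StrictMono pt

/-- The mesh `max_k |t_k - t_{k-1}|`. -/
def IntervalPartition.mesh {T : ℝ} (π : IntervalPartition T) : ℝ :=
  ⨆ k : Fin π.size, |π.pt k.succ - π.pt k.castSucc|

/-- The sum of the `(X_{t_k} - X_{t_{k-1}})²` over the indices `k` with `t_k ≤ t`. -/
def sumSq {Ω : Type*} {T : ℝ} (X : ℝ → Ω → ℝ) (π : IntervalPartition T) (t : ℝ) (ω : Ω) : ℝ :=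
  ∑ k : Fin π.size,
    if π.pt k.succ ≤ t then (X (π.pt k.succ) ω - X (π.pt k.castSucc) ω) ^ 2 else 0

/-- `Q` is the pathwise quadratic variation of `X` on `[0,T]`: along every sequence of partitions
with vanishing mesh the sums of squared increments converge to `Q_t` in probability, for each `t`,
and some subsequence of the partitions has the property that, for almost every path, the sums
along it converge to `Q_t` for all `t ∈ [0,T]` simultaneously. -/
def HasQuadraticVariation {Ω : Type*} [MeasurableSpace Ω] (P : Measure Ω) (T : ℝ)
    (X Q : ℝ → Ω → ℝ) : Prop :=
  ∀ π : ℕ → IntervalPartition T, Tendsto (fun n => (π n).mesh) atTop (𝓝 0) →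
    (∀ t ∈ Set.Icc 0 T, TendstoInMeasure P (fun n => sumSq X (π n) t) atTop (Q t)) ∧
    ∃ φ : ℕ → ℕ, StrictMono φ ∧ ∀ᵐ ω ∂P, ∀ t ∈ Set.Icc 0 T,
      Tendsto (fun n => sumSq X (π (φ n)) t ω) atTop (𝓝 (Q t ω))

end Volterra

end

/-! Write `c j k` for the covariance of two increments of `X` along a partition. It is the
`dm`-integral of the product of the matching increments of `K`, and is nonnegative because `K` is
non-decreasing in its first variable.

Mean. The expected sum of squares is the `dm`-integral over `u` of the sum of squared increments of
`K(·,u)`. That function vanishes before `u`, jumps to `K(u,u)` at `u`, and is monotone and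
continuous afterwards, so only the jump survives in the limit (`tendsto_sum_sq_increments`). Since
`K(T,u)²` dominates, the means converge to `q²(t)`.

Variance. For Gaussian increments the covariance of two squares is `2 (c j k)²`. As `0 ≤ c j k ≤ ε`,
with `ε` bounding the increment variances, the variance is at most `2 ε ∑ c j k = 2 ε E(X_T - X_0)²`
(`integral_sq_sum_sq_sub_le`). Continuity of `t ↦ E X_t²` makes `ε` small with the mesh. This gives
`L²` convergence, hence convergence in probability.

Other `Lᵖ`. The triangle inequality and Gaussian scaling bound every `Lᵖ` norm by a constant times
the mean; interpolation with `L²` finishes (`tendsto_eLpNorm_zero_of_bounded`).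

Paths. A Borel–Cantelli subsequence serves countably many dense times at once; monotonicity in `t`
and continuity of `q²` extend the convergence to all `t`. -/

namespace Volterra

/-! ### Gaussian moments and `Lᵖ` interpolation -/

theorem integral_pow_four_gaussianReal : ∫ x, x ^ 4 ∂(gaussianReal 0 1) = 3 := by
  have h := iteratedDeriv_mgf_zero (X := id) (μ := gaussianReal 0 1) (by simp) 4
  simp only [id, Pi.pow_apply] at h
  rw [← h, mgf_id_gaussianReal]
  -- Differentiation sends `p · exp(t²/2)` to `(p' + t p) · exp(t²/2)`; four rounds from `p = 1`
  -- give the fourth derivative of the moment generating function.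
  have key : ∀ p p' : ℝ → ℝ, (∀ t, HasDerivAt p (p' t) t) →
      deriv (fun t : ℝ => p t * Real.exp (t ^ 2 / 2))
        = fun t => (p' t + t * p t) * Real.exp (t ^ 2 / 2) := by
    intro p p' hp
    funext t
    have h1 : HasDerivAt (fun t : ℝ => Real.exp (t ^ 2 / 2)) (Real.exp (t ^ 2 / 2) * t) t := by
      have : HasDerivAt (fun t : ℝ => t ^ 2 / 2) t t := by
        simpa using (hasDerivAt_pow 2 t).div_const 2
      exact this.exp
    rw [((hp t).fun_mul h1).deriv]
    ring
  have e0 : (fun t : ℝ => Real.exp (0 * t + ((1 : NNReal) : ℝ) * t ^ 2 / 2))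
      = fun t => (fun _ => (1 : ℝ)) t * Real.exp (t ^ 2 / 2) := by
    funext t; simp
  rw [e0]
  simp only [iteratedDeriv_succ, iteratedDeriv_zero]
  have d1 : ∀ t : ℝ, HasDerivAt (fun t : ℝ => 0 + t * 1) 1 t := fun t => by
    simpa using hasDerivAt_id' t
  have d2 : ∀ t : ℝ, HasDerivAt (fun t : ℝ => 1 + t * (0 + t * 1)) (2 * t) t := fun t =>
    (((hasDerivAt_id' t).fun_mul (d1 t)).const_add 1).congr_deriv (by ring)
  have d3 : ∀ t : ℝ, HasDerivAt (fun t : ℝ => 2 * t + t * (1 + t * (0 + t * 1)))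
      (3 + 3 * t ^ 2) t := fun t =>
    (((hasDerivAt_id' t).const_mul 2).fun_add
      ((hasDerivAt_id' t).fun_mul (d2 t))).congr_deriv (by ring)
  rw [key (fun _ => 1) (fun _ => 0) (fun t => hasDerivAt_const t 1), key _ _ d1, key _ _ d2,
    key _ _ d3]
  simp

variable {Ω : Type*} [MeasurableSpace Ω] {P : Measure Ω}

/-- A centered real Gaussian variable is distributed as a multiple of a standard one. -/
theorem map_eq_map_mul_gaussianReal [IsProbabilityMeasure P] {Y : Ω → ℝ} (hY : HasGaussianLaw Y P)
    (h0 : ∫ ω, Y ω ∂P = 0) :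
    P.map Y = (gaussianReal 0 1).map (fun x => √(∫ ω, Y ω ^ 2 ∂P) * x) := by
  have hv : Var[Y; P] = ∫ ω, Y ω ^ 2 ∂P := variance_of_integral_eq_zero hY.aemeasurable h0
  have hnn : 0 ≤ ∫ ω, Y ω ^ 2 ∂P := integral_nonneg fun _ => sq_nonneg _
  rw [hY.map_eq_gaussianReal, gaussianReal_map_const_mul, hv]
  congr 1
  · simp [h0]
  · ext
    simp [hnn]

theorem integral_pow_four_of_hasGaussianLaw [IsProbabilityMeasure P] {Y : Ω → ℝ}
    (hY : HasGaussianLaw Y P) (h0 : ∫ ω, Y ω ∂P = 0) :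
    ∫ ω, Y ω ^ 4 ∂P = 3 * (∫ ω, Y ω ^ 2 ∂P) ^ 2 := by
  have hnn : 0 ≤ ∫ ω, Y ω ^ 2 ∂P := integral_nonneg fun _ => sq_nonneg _
  have h1 : ∫ ω, Y ω ^ 4 ∂P = ∫ y, y ^ 4 ∂(P.map Y) :=
    (integral_map hY.aemeasurable
      (by fun_prop : Continuous fun y : ℝ => y ^ 4).aestronglyMeasurable).symm
  rw [h1, map_eq_map_mul_gaussianReal hY h0, integral_map (by fun_prop)
    (by fun_prop : Continuous fun y : ℝ => y ^ 4).aestronglyMeasurable]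
  simp only [mul_pow]
  rw [integral_const_mul, integral_pow_four_gaussianReal,
    show (4 : ℕ) = 2 * 2 from rfl, pow_mul, Real.sq_sqrt hnn]
  ring

/-- The variance scales out, leaving a factor that depends on `p` alone. Norms of squares therefore
add up exactly as variances do. -/
theorem eLpNorm_sq_of_hasGaussianLaw [IsProbabilityMeasure P] {Y : Ω → ℝ}
    (hY : HasGaussianLaw Y P) (h0 : ∫ ω, Y ω ∂P = 0) (p : ℝ≥0∞) :
    eLpNorm (fun ω => Y ω ^ 2) p P
      = ENNReal.ofReal (∫ ω, Y ω ^ 2 ∂P) * eLpNorm (fun x : ℝ => x ^ 2) p (gaussianReal 0 1) := by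
  have hnn : 0 ≤ ∫ ω, Y ω ^ 2 ∂P := integral_nonneg fun _ => sq_nonneg _
  have hc : Continuous fun y : ℝ => y ^ 2 := by fun_prop
  have h1 : eLpNorm (fun ω => Y ω ^ 2) p P = eLpNorm (fun y : ℝ => y ^ 2) p (P.map Y) :=
    (eLpNorm_map_measure hc.aestronglyMeasurable hY.aemeasurable).symm
  rw [h1, map_eq_map_mul_gaussianReal hY h0, eLpNorm_map_measure hc.aestronglyMeasurable
    (by fun_prop)]
  have : ((fun y : ℝ => y ^ 2) ∘ fun x => √(∫ ω, Y ω ^ 2 ∂P) * x)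
      = (∫ ω, Y ω ^ 2 ∂P) • (fun x : ℝ => x ^ 2) := by
    funext x
    simp [mul_pow, Real.sq_sqrt hnn]
  rw [this, eLpNorm_const_smul, Real.enorm_eq_ofReal hnn]

theorem eLpNorm_sq_gaussianReal_ne_top {p : ℝ≥0∞} (hp : p ≠ ∞) :
    eLpNorm (fun x : ℝ => x ^ 2) p (gaussianReal 0 1) ≠ ∞ := by
  have h := memLp_id_gaussianReal' (μ := 0) (v := 1) (p * 2) (ENNReal.mul_ne_top hp (by simp))
  have h2 : MemLp (fun x : ℝ => x ^ 2) p (gaussianReal 0 1) := by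
    have := h.norm_rpow_div 2
    rw [mul_div_assoc, ENNReal.div_self (by simp) (by simp), mul_one] at this
    refine (memLp_congr_ae (ae_of_all _ fun x => ?_)).1 this
    simp
  exact h2.2.ne

/-- The fourth mixed moment of a centered Gaussian pair. -/
theorem integral_sq_mul_sq_of_hasGaussianLaw {Y Z : Ω → ℝ}
    (h : HasGaussianLaw (fun ω => (Y ω, Z ω)) P) (hY0 : ∫ ω, Y ω ∂P = 0)
    (hZ0 : ∫ ω, Z ω ∂P = 0) :
    ∫ ω, Y ω ^ 2 * Z ω ^ 2 ∂P
      = (∫ ω, Y ω ^ 2 ∂P) * (∫ ω, Z ω ^ 2 ∂P) + 2 * (∫ ω, Y ω * Z ω ∂P) ^ 2 := by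
  have : IsProbabilityMeasure P := h.isProbabilityMeasure
  have hY := h.fst
  have hZ := h.snd
  have hA := h.fun_add
  have hS := h.fun_sub
  have i4 : ∀ {W : Ω → ℝ}, HasGaussianLaw W P → Integrable (fun ω => W ω ^ 4) P := by
    intro W hW
    have := (hW.memLp (p := 4) (by simp)).integrable_norm_pow (by norm_num)
    refine this.congr (ae_of_all _ fun ω => ?_)
    simp only [Real.norm_eq_abs]
    exact Even.pow_abs (by decide) _
  have hYY : Integrable (fun ω => Y ω ^ 2) P := hY.memLp_two.integrable_sq
  have hZZ : Integrable (fun ω => Z ω ^ 2) P := hZ.memLp_two.integrable_sq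
  have hYZ : Integrable (fun ω => Y ω * Z ω) P := hY.memLp_two.integrable_mul hZ.memLp_two
  have hsq : Integrable (fun ω => Y ω ^ 2 + Z ω ^ 2) P := hYY.add hZZ
  have hA2 : ∫ ω, (Y ω + Z ω) ^ 2 ∂P
      = (∫ ω, Y ω ^ 2 ∂P) + (∫ ω, Z ω ^ 2 ∂P) + 2 * ∫ ω, Y ω * Z ω ∂P := by
    rw [← integral_const_mul, ← integral_add hYY hZZ,
      ← integral_add hsq (hYZ.const_mul 2)]
    congr 1; funext ω; ring
  have hS2 : ∫ ω, (Y ω - Z ω) ^ 2 ∂P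
      = (∫ ω, Y ω ^ 2 ∂P) + (∫ ω, Z ω ^ 2 ∂P) - 2 * ∫ ω, Y ω * Z ω ∂P := by
    rw [← integral_const_mul, ← integral_add hYY hZZ,
      ← integral_sub hsq (hYZ.const_mul 2)]
    congr 1; funext ω; ring
  have hA0 : ∫ ω, (Y ω + Z ω) ∂P = 0 := by
    rw [integral_add hY.integrable hZ.integrable, hY0, hZ0, add_zero]
  have hS0 : ∫ ω, (Y ω - Z ω) ∂P = 0 := by
    rw [integral_sub hY.integrable hZ.integrable, hY0, hZ0, sub_zero]
  have j1 : Integrable (fun ω => (Y ω + Z ω) ^ 4 + (Y ω - Z ω) ^ 4) P := (i4 hA).add (i4 hS)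
  have j2 : Integrable (fun ω => (Y ω + Z ω) ^ 4 + (Y ω - Z ω) ^ 4 - 2 * Y ω ^ 4) P :=
    j1.sub ((i4 hY).const_mul 2)
  -- Polarization: `12 y² z² = (y+z)⁴ + (y-z)⁴ - 2y⁴ - 2z⁴`, which reduces the mixed moment to
  -- fourth moments of single Gaussian variables.
  have hpol : ∫ ω, Y ω ^ 2 * Z ω ^ 2 ∂P
      = ((∫ ω, (Y ω + Z ω) ^ 4 ∂P) + (∫ ω, (Y ω - Z ω) ^ 4 ∂P)
        - 2 * (∫ ω, Y ω ^ 4 ∂P) - 2 * ∫ ω, Z ω ^ 4 ∂P) * (1 / 12) := by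
    rw [← integral_const_mul, ← integral_const_mul, ← integral_add (i4 hA) (i4 hS),
      ← integral_sub j1 ((i4 hY).const_mul 2), ← integral_sub j2 ((i4 hZ).const_mul 2),
      ← integral_mul_const]
    congr 1; funext ω; ring
  rw [hpol, integral_pow_four_of_hasGaussianLaw hA hA0, integral_pow_four_of_hasGaussianLaw hS hS0,
    integral_pow_four_of_hasGaussianLaw hY hY0, integral_pow_four_of_hasGaussianLaw hZ hZ0, hA2,
    hS2]
  ring

theorem memLp_two_sq_of_hasGaussianLaw {Y : Ω → ℝ} (hY : HasGaussianLaw Y P) :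
    MemLp (fun ω => Y ω ^ 2) 2 P := by
  rw [memLp_two_iff_integrable_sq (hY.aemeasurable.pow_const 2).aestronglyMeasurable]
  have : IsProbabilityMeasure P := hY.isProbabilityMeasure
  have := (hY.memLp (p := 4) (by simp)).integrable_norm_pow (by norm_num)
  refine this.congr (ae_of_all _ fun ω => ?_)
  simp only [Real.norm_eq_abs, ← pow_mul]
  exact Even.pow_abs (by decide) _

/-- If the entries of a centered Gaussian vector are nonnegatively correlated and have variance at
most `ε`, then the variance of a sum of their squares is at most `2 ε` times the second moment of
the sum of all entries. -/
theorem integral_sq_sum_sq_sub_le {ι : Type*} [Fintype ι] {Y : ι → Ω → ℝ}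
    (hY : HasGaussianLaw (fun ω i => Y i ω) P) (h0 : ∀ i, ∫ ω, Y i ω ∂P = 0)
    (hnn : ∀ i j, 0 ≤ ∫ ω, Y i ω * Y j ω ∂P) {ε : ℝ} (hε : ∀ i j, ∫ ω, Y i ω * Y j ω ∂P ≤ ε)
    (S : Finset ι) :
    ∫ ω, (∑ i ∈ S, Y i ω ^ 2 - ∑ i ∈ S, ∫ ω, Y i ω ^ 2 ∂P) ^ 2 ∂P
      ≤ 2 * ε * ∫ ω, (∑ i, Y i ω) ^ 2 ∂P := by
  have : IsProbabilityMeasure P := hY.isProbabilityMeasure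
  have hg : ∀ i, HasGaussianLaw (Y i) P := fun i => hY.eval i
  have hm : ∀ i, MemLp (fun ω => Y i ω ^ 2) 2 P := fun i => memLp_two_sq_of_hasGaussianLaw (hg i)
  set c : ι → ℝ := fun i => ∫ ω, Y i ω ^ 2 ∂P with hc
  have hmc : ∀ i, MemLp (fun ω => Y i ω ^ 2 - c i) 2 P := fun i => (hm i).sub (memLp_const _)
  have hterm : ∀ i j, ∫ ω, (Y i ω ^ 2 - c i) * (Y j ω ^ 2 - c j) ∂P
      = 2 * (∫ ω, Y i ω * Y j ω ∂P) ^ 2 := by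
    intro i j
    have h1 := integral_sq_mul_sq_of_hasGaussianLaw (hY.prodMk i j) (h0 i) (h0 j)
    have i1 : Integrable (fun ω => Y i ω ^ 2 * Y j ω ^ 2) P := (hm i).integrable_mul (hm j)
    have i2 : Integrable (fun ω => Y i ω ^ 2) P := (hm i).integrable (by norm_num)
    have i3 : Integrable (fun ω => Y j ω ^ 2) P := (hm j).integrable (by norm_num)
    have : ∀ ω, (Y i ω ^ 2 - c i) * (Y j ω ^ 2 - c j)
        = Y i ω ^ 2 * Y j ω ^ 2 - c j * Y i ω ^ 2 - c i * Y j ω ^ 2 + c i * c j := by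
      intro ω; ring
    have i4 : Integrable (fun ω => Y i ω ^ 2 * Y j ω ^ 2 - c j * Y i ω ^ 2) P :=
      i1.sub (i2.const_mul _)
    have i5 : Integrable (fun ω => Y i ω ^ 2 * Y j ω ^ 2 - c j * Y i ω ^ 2 - c i * Y j ω ^ 2) P :=
      i4.sub (i3.const_mul _)
    simp_rw [this]
    rw [integral_add i5 (integrable_const _), integral_sub i4 (i3.const_mul _),
      integral_sub i1 (i2.const_mul _), integral_const_mul, integral_const_mul, h1]
    simp [hc]
    ring
  have hexp : ∫ ω, (∑ i ∈ S, Y i ω ^ 2 - ∑ i ∈ S, c i) ^ 2 ∂P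
      = ∑ i ∈ S, ∑ j ∈ S, 2 * (∫ ω, Y i ω * Y j ω ∂P) ^ 2 := by
    have : ∀ ω, (∑ i ∈ S, Y i ω ^ 2 - ∑ i ∈ S, c i) ^ 2
        = ∑ i ∈ S, ∑ j ∈ S, (Y i ω ^ 2 - c i) * (Y j ω ^ 2 - c j) := by
      intro ω
      rw [← Finset.sum_sub_distrib, sq, Finset.sum_mul_sum]
    have hi : ∀ i j, Integrable (fun ω => (Y i ω ^ 2 - c i) * (Y j ω ^ 2 - c j)) P :=
      fun i j => (hmc i).integrable_mul (hmc j)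
    simp_rw [this]
    rw [integral_finsetSum _ fun i _ => integrable_finsetSum _ fun j _ => hi i j]
    refine Finset.sum_congr rfl fun i _ => ?_
    rw [integral_finsetSum _ fun j _ => hi i j]
    exact Finset.sum_congr rfl fun j _ => hterm i j
  have hall : ∫ ω, (∑ i, Y i ω) ^ 2 ∂P = ∑ i, ∑ j, ∫ ω, Y i ω * Y j ω ∂P := by
    have hi : ∀ i j, Integrable (fun ω => Y i ω * Y j ω) P :=
      fun i j => (hg i).memLp_two.integrable_mul (hg j).memLp_two
    simp_rw [sq, Finset.sum_mul_sum]
    rw [integral_finsetSum _ fun i _ => integrable_finsetSum _ fun j _ => hi i j]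
    exact Finset.sum_congr rfl fun i _ => integral_finsetSum _ fun j _ => hi i j
  rw [hexp, hall, Finset.mul_sum]
  have hle : ∀ i j, 2 * (∫ ω, Y i ω * Y j ω ∂P) ^ 2 ≤ 2 * ε * ∫ ω, Y i ω * Y j ω ∂P := by
    intro i j
    nlinarith [mul_le_mul_of_nonneg_right (hε i j) (hnn i j)]
  have hnn2 : ∀ i j, 0 ≤ 2 * (∫ ω, Y i ω * Y j ω ∂P) ^ 2 := fun i j => by positivity
  -- Enlarging `S` to all indices costs nothing, the terms being nonnegative, and makes the double
  -- sum of covariances equal to the second moment of the full sum.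
  calc ∑ i ∈ S, ∑ j ∈ S, 2 * (∫ ω, Y i ω * Y j ω ∂P) ^ 2
      ≤ ∑ i, ∑ j, 2 * (∫ ω, Y i ω * Y j ω ∂P) ^ 2 :=
        (Finset.sum_le_sum fun i _ => Finset.sum_le_univ_sum_of_nonneg fun j => hnn2 i j).trans
          (Finset.sum_le_univ_sum_of_nonneg fun i => Finset.sum_nonneg fun j _ => hnn2 i j)
    _ ≤ ∑ i, 2 * ε * ∑ j, ∫ ω, Y i ω * Y j ω ∂P := by
        refine Finset.sum_le_sum fun i _ => ?_
        rw [Finset.mul_sum]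
        exact Finset.sum_le_sum fun j _ => hle i j

/-- `L²` convergence to zero together with boundedness in a higher `Lᵖ` gives convergence to zero
in the intermediate space. -/
theorem tendsto_eLpNorm_zero_of_bounded [IsProbabilityMeasure P] {W : ℕ → Ω → ℝ}
    (hW : ∀ n, AEStronglyMeasurable (W n) P)
    (h2 : Tendsto (fun n => eLpNorm (W n) 2 P) atTop (𝓝 0))
    (hb : ∀ p : ℝ≥0∞, 1 ≤ p → p ≠ ∞ → ∃ C : ℝ≥0∞, C ≠ ∞ ∧ ∀ᶠ n in atTop, eLpNorm (W n) p P ≤ C)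
    {p : ℝ≥0∞} (hp1 : 1 ≤ p) (hp : p ≠ ∞) :
    Tendsto (fun n => eLpNorm (W n) p P) atTop (𝓝 0) := by
  set x : ℝ := p.toReal with hx
  have hx1 : 1 ≤ x := by simpa using ENNReal.toReal_mono hp hp1
  have hp' : p = ENNReal.ofReal x := (ENNReal.ofReal_toReal hp).symm
  -- Hölder is applied to `|W| = |W|^θ |W|^(1-θ)` in `L^R`, with both exponents `2R`. The choice `R
  -- = p + 1`, `θ = 1/(p+1)` turns the two factors into powers of the norms in `L²` and `L^(2p)`,
  -- with no case split at `p = 2`.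
  set R : ℝ≥0∞ := ENNReal.ofReal (x + 1) with hR
  have hR0 : R ≠ 0 := by simp [hR]; linarith
  have : ENNReal.HolderTriple (2 * R) (2 * R) R := ⟨by
    rw [ENNReal.mul_inv (by simp) (by simp), ← add_mul, ENNReal.inv_two_add_inv_two, one_mul]⟩
  set θ : ℝ := 1 / (x + 1) with hθ
  have hθ0 : 0 < θ := by positivity
  have hθ1 : 0 < 1 - θ := by
    rw [hθ, sub_pos, div_lt_one (by linarith)]; linarith
  have e1 : 2 * R * ENNReal.ofReal θ = 2 := by
    rw [mul_assoc, hR, ← ENNReal.ofReal_mul (by linarith), hθ, mul_one_div_cancel (by linarith)]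
    simp
  have e2 : 2 * R * ENNReal.ofReal (1 - θ) = 2 * p := by
    rw [mul_assoc, hR, ← ENNReal.ofReal_mul (by linarith), hθ, hp']
    congr 2
    field_simp
    ring
  have hbound : ∀ n, eLpNorm (W n) p P
      ≤ eLpNorm (W n) 2 P ^ θ * eLpNorm (W n) (2 * p) P ^ (1 - θ) := by
    intro n
    have hpR : p ≤ R := by rw [hp', hR]; exact ENNReal.ofReal_le_ofReal (by linarith)
    have hm : ∀ q : ℝ, AEStronglyMeasurable (fun ω => ‖W n ω‖ ^ q) P := fun q =>
      ((hW n).aemeasurable.norm.pow_const q).aestronglyMeasurable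
    calc eLpNorm (W n) p P ≤ eLpNorm (W n) R P := eLpNorm_le_eLpNorm_of_exponent_le hpR (hW n)
      _ = eLpNorm ((fun ω => ‖W n ω‖ ^ θ) • fun ω => ‖W n ω‖ ^ (1 - θ)) R P := by
          refine eLpNorm_congr_norm_ae (ae_of_all _ fun ω => ?_)
          rw [Pi.smul_apply', smul_eq_mul, ← Real.rpow_add_of_nonneg (norm_nonneg _) hθ0.le hθ1.le]
          simp
      _ ≤ eLpNorm (fun ω => ‖W n ω‖ ^ θ) (2 * R) P
          * eLpNorm (fun ω => ‖W n ω‖ ^ (1 - θ)) (2 * R) P :=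
          eLpNorm_smul_le_mul_eLpNorm (hm _) (hm _)
      _ = _ := by
          rw [eLpNorm_norm_rpow _ hθ0, eLpNorm_norm_rpow _ hθ1, e1, e2]
  obtain ⟨C, hC, hbC⟩ := hb (2 * p) (hp1.trans (le_mul_of_one_le_left' (by norm_num)))
    (ENNReal.mul_ne_top (by simp) hp)
  have hlim : Tendsto (fun n => eLpNorm (W n) 2 P ^ θ * C ^ (1 - θ)) atTop (𝓝 0) := by
    have h1 : Tendsto (fun n => eLpNorm (W n) 2 P ^ θ) atTop (𝓝 0) := by
      have := (ENNReal.continuous_rpow_const (y := θ)).tendsto 0 |>.comp h2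
      rwa [ENNReal.zero_rpow_of_pos hθ0] at this
    have := ENNReal.Tendsto.mul_const h1
      (Or.inr (ENNReal.rpow_ne_top_of_nonneg hθ1.le hC) : (0 : ℝ≥0∞) ≠ 0 ∨ C ^ (1 - θ) ≠ ∞)
    rwa [zero_mul] at this
  refine tendsto_of_tendsto_of_tendsto_of_le_of_le' tendsto_const_nhds hlim
    (Eventually.of_forall fun _ => zero_le) ?_
  filter_upwards [hbC] with n hn
  exact (hbound n).trans (by gcongr)

end Volterra

/-! ### Partitions and squared increments of a monotone function with one jump -/

namespace Volterra

theorem sum_succ_sub_castSucc {n : ℕ} (f : Fin (n + 1) → ℝ) :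
    ∑ k : Fin n, (f k.succ - f k.castSucc) = f (Fin.last n) - f 0 := by
  induction n with
  | zero => simp
  | succ n ih =>
    rw [Fin.sum_univ_castSucc]
    have := ih fun k => f k.castSucc
    simp only [Fin.castSucc_zero] at this
    simp only [Fin.succ_castSucc, this, Fin.succ_last]
    ring

namespace IntervalPartition

variable {T : ℝ} (π : IntervalPartition T)

theorem pt_mem (k : Fin (π.size + 1)) : π.pt k ∈ Set.Icc 0 T := by
  constructor
  · rw [← π.pt_zero]
    exact π.strictMono.monotone (Fin.zero_le k)
  · conv_rhs => rw [← π.pt_last]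
    exact π.strictMono.monotone (Fin.le_last k)

theorem pt_castSucc_le_succ (k : Fin π.size) : π.pt k.castSucc ≤ π.pt k.succ :=
  π.strictMono.monotone k.castSucc_lt_succ.le

theorem sub_le_mesh (k : Fin π.size) : π.pt k.succ - π.pt k.castSucc ≤ π.mesh :=
  (le_abs_self _).trans
    (le_ciSup (f := fun k : Fin π.size => |π.pt k.succ - π.pt k.castSucc|)
      (Set.finite_range _).bddAbove k)

theorem sum_increments (f : ℝ → ℝ) :
    ∑ k : Fin π.size, (f (π.pt k.succ) - f (π.pt k.castSucc)) = f T - f 0 := by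
  have := sum_succ_sub_castSucc fun k => f (π.pt k)
  simpa [π.pt_last, π.pt_zero] using this

theorem increment_nonneg {h : ℝ → ℝ} (hm : MonotoneOn h (Set.Icc 0 T)) (k : Fin π.size) :
    0 ≤ h (π.pt k.succ) - h (π.pt k.castSucc) :=
  sub_nonneg.2 (hm (π.pt_mem _) (π.pt_mem _) (π.pt_castSucc_le_succ k))

/-- For nonnegative increments the sum of squares is at most the square of the telescoping sum. This
supplies the dominating function `K(T,u)²`. -/
theorem sum_sq_increments_le {h : ℝ → ℝ} (hm : MonotoneOn h (Set.Icc 0 T)) (t : ℝ) :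
    (∑ k : Fin π.size, if π.pt k.succ ≤ t then
      (h (π.pt k.succ) - h (π.pt k.castSucc)) ^ 2 else 0) ≤ (h T - h 0) ^ 2 := by
  calc _ ≤ ∑ k : Fin π.size, (h (π.pt k.succ) - h (π.pt k.castSucc)) ^ 2 := by
        refine Finset.sum_le_sum fun k _ => ?_
        split_ifs
        · exact le_rfl
        · positivity
    _ ≤ (∑ k : Fin π.size, (h (π.pt k.succ) - h (π.pt k.castSucc))) ^ 2 :=
        Finset.sum_sq_le_sq_sum_of_nonneg fun k _ => π.increment_nonneg hm k
    _ = _ := by rw [π.sum_increments]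

end IntervalPartition

/-- The squared increments of a non-decreasing function whose only jump is from `0` at `u`
converge to the squared jump. -/
theorem tendsto_sum_sq_increments {T : ℝ} {h : ℝ → ℝ} {u t : ℝ} (hu : u ∈ Set.Ioo 0 T)
    (hm : MonotoneOn h (Set.Icc 0 T)) (h0 : ∀ x ∈ Set.Icc 0 T, x < u → h x = 0)
    (hc : ContinuousOn h (Set.Icc u T)) (hut : u ≠ t) {π : ℕ → IntervalPartition T}
    (hπ : Tendsto (fun n => (π n).mesh) atTop (𝓝 0)) :
    Tendsto (fun n => ∑ k : Fin (π n).size, if (π n).pt k.succ ≤ t then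
      (h ((π n).pt k.succ) - h ((π n).pt k.castSucc)) ^ 2 else 0) atTop
      (𝓝 (if u < t then h u ^ 2 else 0)) := by
  rcases lt_or_gt_of_ne hut with hlt | hgt
  swap
  · rw [if_neg hgt.not_gt]
    refine tendsto_const_nhds.congr fun n => ?_
    symm
    refine Finset.sum_eq_zero fun k _ => ?_
    split_ifs with hk
    · rw [h0 _ ((π n).pt_mem _) (hk.trans_lt hgt),
        h0 _ ((π n).pt_mem _) ((((π n).pt_castSucc_le_succ k).trans hk).trans_lt hgt)]
      simp
    · rfl
  rw [if_pos hlt]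
  have huI : u ∈ Set.Icc 0 T := Set.Ioo_subset_Icc_self hu
  have hTI : T ∈ Set.Icc 0 T := ⟨hu.1.le.trans hu.2.le, le_rfl⟩
  have h0I : (0 : ℝ) ∈ Set.Icc 0 T := ⟨le_rfl, hTI.1⟩
  -- On `[0,T]`, `h` splits into a continuous monotone part `r`, frozen to the left of `u`, and `h
  -- u` times the unit step `e`, up to the constant `h u`.
  set r : ℝ → ℝ := fun x => h (max x u) with hr
  set e : ℝ → ℝ := fun x => if u ≤ x then 1 else 0 with he
  have hmax : ∀ x ∈ Set.Icc 0 T, max x u ∈ Set.Icc u T :=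
    fun x hx => ⟨le_max_right _ _, max_le hx.2 hu.2.le⟩
  have hsub : Set.Icc u T ⊆ Set.Icc 0 T := Set.Icc_subset_Icc_left hu.1.le
  have hrm : MonotoneOn r (Set.Icc 0 T) := fun x hx y hy hxy =>
    hm (hsub (hmax x hx)) (hsub (hmax y hy)) (max_le_max_right u hxy)
  have hrc : ContinuousOn r (Set.Icc 0 T) :=
    hc.comp (by fun_prop) hmax
  have hem : Monotone e := by
    intro x y hxy
    simp only [he]
    split_ifs <;> linarith
  have hhr : ∀ x ∈ Set.Icc 0 T, h x = r x - h u + h u * e x := by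
    intro x hx
    simp only [hr, he]
    split_ifs with h1
    · rw [max_eq_left h1]; ring
    · rw [max_eq_right (not_le.1 h1).le, h0 x hx (not_le.1 h1)]; ring
  have hu0 : 0 ≤ h u := by
    rw [← h0 0 h0I hu.1]; exact hm h0I huI hu.1.le
  have huT : h u ≤ h T := hm huI hTI hu.2.le
  have huc := isCompact_Icc.uniformContinuousOn_of_continuous hrc
  rw [Metric.uniformContinuousOn_iff] at huc
  rw [Metric.tendsto_atTop]
  intro ε hε
  have hpos : 0 < h T + h u + 1 := by linarith
  obtain ⟨δ, hδ, hδr⟩ := huc (ε / (h T + h u + 1)) (div_pos hε hpos)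
  -- A mesh below `t - u` forces the interval carrying the jump to end before `t`, so its term is
  -- counted.
  have hev : ∀ᶠ n in atTop, (π n).mesh < min δ (t - u) :=
    hπ.eventually_lt_const (lt_min hδ (by linarith))
  obtain ⟨N, hN⟩ := eventually_atTop.1 hev
  refine ⟨N, fun n hn => ?_⟩
  have hmesh := hN n hn
  set p := π n
  set η := ε / (h T + h u + 1) with hη
  have hη0 : 0 < η := div_pos hε hpos
  have hr_le : ∀ k : Fin p.size, r (p.pt k.succ) - r (p.pt k.castSucc) ≤ η := by
    intro k
    have h1 := hδr _ (p.pt_mem k.succ) _ (p.pt_mem k.castSucc) (by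
      rw [Real.dist_eq, abs_of_nonneg (sub_nonneg.2 (p.pt_castSucc_le_succ k))]
      exact (p.sub_le_mesh k).trans_lt (hmesh.trans_le (min_le_left _ _)))
    rw [Real.dist_eq] at h1
    exact (le_abs_self _).trans h1.le
  -- With `a`, `b` the increments of `r`, `e` one has `b² = b`, so the error of a counted term is `a
  -- (a + 2 h(u) b)` and `a ≤ η`. A term that is not counted has `b = 0`. The bounds telescope to `η
  -- (h T + h u)`.
  have hterm : ∀ k : Fin p.size,
      |(if p.pt k.succ ≤ t then (h (p.pt k.succ) - h (p.pt k.castSucc)) ^ 2 else 0)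
        - h u ^ 2 * (e (p.pt k.succ) - e (p.pt k.castSucc))|
      ≤ η * ((r (p.pt k.succ) - r (p.pt k.castSucc))
        + 2 * h u * (e (p.pt k.succ) - e (p.pt k.castSucc))) := by
    intro k
    have hr0 := p.increment_nonneg hrm k
    have he0 := p.increment_nonneg (hem.monotoneOn _) k
    have hrη := hr_le k
    have hek : (e (p.pt k.succ) - e (p.pt k.castSucc)) = 0
        ∨ (e (p.pt k.succ) - e (p.pt k.castSucc) = 1 ∧ p.pt k.castSucc < u) := by
      have := p.pt_castSucc_le_succ k
      simp only [he]
      split_ifs with h1 h2 h2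
      · left; simp
      · right; exact ⟨by simp, not_le.1 h2⟩
      · linarith
      · left; simp
    rw [hhr _ (p.pt_mem k.succ), hhr _ (p.pt_mem k.castSucc)]
    set a := r (p.pt k.succ) - r (p.pt k.castSucc)
    set b := e (p.pt k.succ) - e (p.pt k.castSucc)
    have hab : r (p.pt k.succ) - h u + h u * e (p.pt k.succ)
        - (r (p.pt k.castSucc) - h u + h u * e (p.pt k.castSucc)) = a + h u * b := by
      simp only [a, b]; ring
    rw [hab]
    have hrhs : 0 ≤ η * (a + 2 * h u * b) := by positivity
    rcases hek with hb | ⟨hb, hlt'⟩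
    · rw [hb] at hrhs ⊢
      split_ifs
      · rw [abs_of_nonneg (by nlinarith [sq_nonneg a])]
        nlinarith
      · simpa using hrhs
    · have : p.pt k.succ ≤ t := by
        have h1 := p.sub_le_mesh k
        have h2 := hmesh.trans_le (min_le_right _ _)
        linarith
      rw [if_pos this, hb]
      have : (a + h u * 1) ^ 2 - h u ^ 2 * 1 = a * (a + 2 * h u * 1) := by ring
      rw [this, abs_of_nonneg (by positivity)]
      exact mul_le_mul_of_nonneg_right hrη (by positivity)
  have hesum : ∑ k : Fin p.size, (e (p.pt k.succ) - e (p.pt k.castSucc)) = 1 := by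
    rw [p.sum_increments]
    simp [he, hu.2.le, hu.1]
  have hrsum : ∑ k : Fin p.size, (r (p.pt k.succ) - r (p.pt k.castSucc)) = h T - h u := by
    rw [p.sum_increments]
    simp [hr, max_eq_left hu.2.le, max_eq_right hu.1.le]
  rw [Real.dist_eq]
  calc _ = |∑ k : Fin p.size,
        ((if p.pt k.succ ≤ t then (h (p.pt k.succ) - h (p.pt k.castSucc)) ^ 2 else 0)
          - h u ^ 2 * (e (p.pt k.succ) - e (p.pt k.castSucc)))| := by
        rw [Finset.sum_sub_distrib, ← Finset.mul_sum, hesum, mul_one]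
    _ ≤ ∑ k : Fin p.size, η * ((r (p.pt k.succ) - r (p.pt k.castSucc))
        + 2 * h u * (e (p.pt k.succ) - e (p.pt k.castSucc))) :=
        (Finset.abs_sum_le_sum_abs _ _).trans (Finset.sum_le_sum fun k _ => hterm k)
    _ = η * (h T + h u) := by
        rw [← Finset.mul_sum, Finset.sum_add_distrib, ← Finset.mul_sum, hesum, hrsum]
        ring
    _ < η * (h T + h u + 1) := by
        apply mul_lt_mul_of_pos_left _ hη0; linarith
    _ = ε := by
        rw [hη, div_mul_cancel₀ _ hpos.ne']

/-! ### The measure `dm` has no atoms -/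

section Clock

variable {T : ℝ} {m : StieltjesFunction ℝ}

instance : IsFiniteMeasure (clock T m) := by
  refine ⟨?_⟩
  rw [clock, Measure.restrict_apply_univ, StieltjesFunction.measure_Ioc]
  exact ENNReal.ofReal_lt_top

theorem clock_singleton (hm : ContinuousOn m (Set.Icc 0 T)) {t : ℝ} (ht : t ∈ Set.Icc 0 T) :
    clock T m {t} = 0 := by
  rw [clock, Measure.restrict_apply (measurableSet_singleton t)]
  -- Continuity on `[0,T]` says nothing about the left limit at `0`, but `0` lies outside `Ioc 0 T`.
  rcases eq_or_lt_of_le ht.1 with h0 | h0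
  · subst h0
    rw [Set.singleton_inter_eq_empty.2 (by simp), measure_empty]
  refine measure_mono_null Set.inter_subset_left ?_
  rw [StieltjesFunction.measure_singleton]
  have h1 : Tendsto m (𝓝[<] t) (𝓝 (m t)) := by
    refine (hm t ht).mono_left ?_
    rw [← nhdsWithin_Ioo_eq_nhdsLT h0]
    exact nhdsWithin_mono _ fun x hx => ⟨hx.1.le, hx.2.le.trans ht.2⟩
  have h2 := m.mono.tendsto_leftLim t
  rw [tendsto_nhds_unique h2 h1]
  simp

theorem ae_clock_ne (hm : ContinuousOn m (Set.Icc 0 T)) {t : ℝ} (ht : t ∈ Set.Icc 0 T) :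
    ∀ᵐ u ∂(clock T m), u ≠ t := by
  have := clock_singleton hm ht
  rw [ae_iff]
  simpa using this

theorem ae_clock_mem_Ioo (hT : 0 < T) (hm : ContinuousOn m (Set.Icc 0 T)) :
    ∀ᵐ u ∂(clock T m), u ∈ Set.Ioo 0 T := by
  have h1 : ∀ᵐ u ∂(clock T m), u ∈ Set.Ioc 0 T := ae_restrict_mem measurableSet_Ioc
  filter_upwards [h1, ae_clock_ne hm (⟨hT.le, le_rfl⟩ : T ∈ Set.Icc 0 T)] with u hu hne
  exact ⟨hu.1, lt_of_le_of_ne hu.2 hne⟩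

/-- Since `{t}` is null, the cutoff may be taken strict. The variable `t` moves from the domain to
the integrand, ready for dominated convergence. -/
theorem setIntegral_Ioc_eq_clock {t : ℝ} (ht : t ∈ Set.Icc 0 T)
    (hm : ContinuousOn m (Set.Icc 0 T)) (f : ℝ → ℝ) :
    ∫ u in Set.Ioc 0 t, f u ∂m.measure = ∫ u, (if u < t then f u else 0) ∂(clock T m) := by
  have h1 : (m.measure.restrict (Set.Ioc 0 t)) = (clock T m).restrict (Set.Iic t) := by
    rw [clock, Measure.restrict_restrict measurableSet_Iic]
    congr 1
    ext x
    simp only [Set.mem_Ioc, Set.mem_inter_iff, Set.mem_Iic]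
    exact ⟨fun h => ⟨h.2, h.1, h.2.trans ht.2⟩, fun h => ⟨h.2.1, h.1⟩⟩
  rw [h1, ← integral_indicator measurableSet_Iic]
  refine integral_congr_ae ?_
  filter_upwards [ae_clock_ne hm ht] with u hu
  by_cases hut : u < t
  · simp [hut, hut.le]
  · have : ¬ u ≤ t := fun h => hut (lt_of_le_of_ne h hu)
    simp [hut, this]

end Clock

/-! ### Kernel estimates and convergence of the means -/

namespace IsRegularInvertiblePair

variable {T : ℝ} {m : StieltjesFunction ℝ} {K : ℝ → ℝ → ℝ}

theorem nonneg (hK : IsRegularInvertiblePair T m K) {u t : ℝ} (hu : u ∈ Set.Ioo 0 T)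
    (ht : t ∈ Set.Icc 0 T) : 0 ≤ K t u := by
  have h0 : (0 : ℝ) ∈ Set.Icc 0 T := ⟨le_rfl, ht.1.trans ht.2⟩
  rw [← hK.volterra u (Set.Ioo_subset_Icc_self hu) 0 h0 hu.1]
  exact hK.monotone u hu h0 ht ht.1

theorem le_terminal (hK : IsRegularInvertiblePair T m K) {u t : ℝ} (hu : u ∈ Set.Ioo 0 T)
    (ht : t ∈ Set.Icc 0 T) : K t u ≤ K T u :=
  hK.monotone u hu ht ⟨ht.1.trans ht.2, le_rfl⟩ ht.2

/-- The diagonal is the only possible discontinuity: to its left `K(·,u)` is zero, to its right it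
is continuous by assumption. -/
theorem continuousWithinAt (hK : IsRegularInvertiblePair T m K) {u t : ℝ} (hu : u ∈ Set.Ioo 0 T)
    (ht : t ∈ Set.Icc 0 T) (hut : u ≠ t) :
    ContinuousWithinAt (fun s => K s u) (Set.Icc 0 T) t := by
  rcases lt_or_gt_of_ne hut with hlt | hgt
  · have h1 := hK.continuous_to_diagonal u hu t ⟨hlt.le, ht.2⟩
    refine h1.mono_of_mem_nhdsWithin ?_
    have : Set.Ici u ∈ 𝓝[Set.Icc 0 T] t := nhdsWithin_le_nhds (Ici_mem_nhds hlt)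
    filter_upwards [this, self_mem_nhdsWithin] with x hx hx'
    exact ⟨hx, hx'.2⟩
  · have huI := Set.Ioo_subset_Icc_self hu
    refine (continuousWithinAt_const (b := (0 : ℝ))).congr_of_eventuallyEq ?_
      (hK.volterra u huI t ht hgt)
    have : Set.Iio u ∈ 𝓝[Set.Icc 0 T] t := nhdsWithin_le_nhds (Iio_mem_nhds hgt)
    filter_upwards [this, self_mem_nhdsWithin] with x hx hx'
    exact hK.volterra u huI x hx' hx

theorem aestronglyMeasurable_diagonal (hT : 0 < T) (hK : IsRegularInvertiblePair T m K) :
    AEStronglyMeasurable (fun u => K u u) (clock T m) := by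
  have h : clock T m = (clock T m).restrict (Set.Ioo 0 T) :=
    (Measure.restrict_eq_self_of_ae_mem (ae_clock_mem_Ioo hT hK.clock_continuous)).symm
  rw [h]
  exact hK.contDiff_diagonal.continuousOn.aestronglyMeasurable measurableSet_Ioo

theorem integrable_diagonal_sq (hT : 0 < T) (hK : IsRegularInvertiblePair T m K)
    (hL : MemLp (fun u => K T u) 2 (clock T m)) :
    Integrable (fun u => K u u ^ 2) (clock T m) := by
  refine hL.integrable_sq.mono' ((hK.aestronglyMeasurable_diagonal hT).pow 2) ?_
  filter_upwards [ae_clock_mem_Ioo hT hK.clock_continuous] with u hu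
  have huI := Set.Ioo_subset_Icc_self hu
  have h1 := hK.nonneg hu huI
  have h2 := hK.le_terminal hu huI
  rw [Real.norm_of_nonneg (by positivity)]
  gcongr

/-- Dominated convergence with bound `K(T,·)²`; the discontinuity at `u = t` is `dm`-null. Uniform
continuity of this function later makes all increment variances small. -/
theorem continuousOn_integral_sq (hT : 0 < T) (hK : IsRegularInvertiblePair T m K)
    (hL : ∀ t ∈ Set.Icc 0 T, MemLp (fun u => K t u) 2 (clock T m)) :
    ContinuousOn (fun t => ∫ u, K t u ^ 2 ∂(clock T m)) (Set.Icc 0 T) := by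
  intro t ht
  have hTI : T ∈ Set.Icc 0 T := ⟨hT.le, le_rfl⟩
  refine continuousWithinAt_of_dominated (bound := fun u => K T u ^ 2) ?_ ?_
    (hL T hTI).integrable_sq ?_
  · filter_upwards [self_mem_nhdsWithin] with s hs
    exact (hL s hs).1.pow 2
  · filter_upwards [self_mem_nhdsWithin] with s hs
    filter_upwards [ae_clock_mem_Ioo hT hK.clock_continuous] with u hu
    have h1 := hK.nonneg hu hs
    have h2 := hK.le_terminal hu hs
    rw [Real.norm_of_nonneg (by positivity)]
    gcongr
  · filter_upwards [ae_clock_mem_Ioo hT hK.clock_continuous, ae_clock_ne hK.clock_continuous ht]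
      with u hu hut
    exact (hK.continuousWithinAt hu ht hut).pow 2

theorem continuousOn_quadraticVariation (hT : 0 < T) (hK : IsRegularInvertiblePair T m K)
    (hL : MemLp (fun u => K T u) 2 (clock T m)) :
    ContinuousOn (fun t => ∫ s in Set.Ioc 0 t, K s s ^ 2 ∂m.measure) (Set.Icc 0 T) := by
  have hint := hK.integrable_diagonal_sq hT hL
  refine ContinuousOn.congr ?_ fun t ht => setIntegral_Ioc_eq_clock ht hK.clock_continuous _
  intro t ht
  refine continuousWithinAt_of_dominated (bound := fun u => K u u ^ 2) ?_ ?_ hint ?_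
  · refine Eventually.of_forall fun s => ?_
    have := hint.1.indicator (measurableSet_Iio (a := s))
    refine this.congr (ae_of_all _ fun u => ?_)
    simp [Set.indicator_apply]
  · refine Eventually.of_forall fun s => ae_of_all _ fun u => ?_
    split_ifs
    · rw [Real.norm_of_nonneg (by positivity)]
    · simp; positivity
  · filter_upwards [ae_clock_ne hK.clock_continuous ht] with u hut
    refine ContinuousAt.continuousWithinAt ?_
    rcases lt_or_gt_of_ne hut with hlt | hgt
    · refine (continuousAt_const (y := K u u ^ 2)).congr ?_
      filter_upwards [Ioi_mem_nhds hlt] with s hs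
      rw [if_pos (by exact hs)]
    · refine (continuousAt_const (y := (0 : ℝ))).congr ?_
      filter_upwards [Iio_mem_nhds hgt] with s hs
      rw [if_neg (not_lt.2 (le_of_lt hs))]

/-- Here `sumSq` is applied to `K` itself, with `u` in the role of the sample point. -/
theorem tendsto_integral_sumSq (hT : 0 < T) (hK : IsRegularInvertiblePair T m K)
    (hL : ∀ t ∈ Set.Icc 0 T, MemLp (fun u => K t u) 2 (clock T m))
    {π : ℕ → IntervalPartition T} (hπ : Tendsto (fun n => (π n).mesh) atTop (𝓝 0))
    {t : ℝ} (ht : t ∈ Set.Icc 0 T) :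
    Tendsto (fun n => ∫ u, sumSq K (π n) t u ∂(clock T m)) atTop
      (𝓝 (∫ s in Set.Ioc 0 t, K s s ^ 2 ∂m.measure)) := by
  have hTI : T ∈ Set.Icc 0 T := ⟨hT.le, le_rfl⟩
  rw [setIntegral_Ioc_eq_clock ht hK.clock_continuous]
  refine tendsto_integral_of_dominated_convergence (fun u => K T u ^ 2) ?_
    (hL T hTI).integrable_sq ?_ ?_
  · intro n
    unfold sumSq
    refine Finset.aestronglyMeasurable_fun_sum _ fun k _ => ?_
    split_ifs
    · exact ((hL _ ((π n).pt_mem _)).1.sub (hL _ ((π n).pt_mem _)).1).pow 2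
    · exact aestronglyMeasurable_const
  · intro n
    filter_upwards [ae_clock_mem_Ioo hT hK.clock_continuous] with u hu
    have h1 := (π n).sum_sq_increments_le (hK.monotone u hu) t
    rw [hK.volterra u (Set.Ioo_subset_Icc_self hu) 0 ⟨le_rfl, hT.le⟩ hu.1, sub_zero] at h1
    rw [Real.norm_of_nonneg]
    · exact h1
    · exact Finset.sum_nonneg fun k _ => by split_ifs <;> positivity
  · filter_upwards [ae_clock_mem_Ioo hT hK.clock_continuous, ae_clock_ne hK.clock_continuous ht]
      with u hu hut
    exact tendsto_sum_sq_increments hu (hK.monotone u hu)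
      (fun x hx => hK.volterra u (Set.Ioo_subset_Icc_self hu) x hx)
      (hK.continuous_to_diagonal u hu) hut hπ

end IsRegularInvertiblePair

end Volterra

/-! ### Common subsequences and convergence of monotone functions -/

namespace Volterra

section Convergence

variable {Ω : Type*} [MeasurableSpace Ω] {P : Measure Ω}

/-- Countably many sequences that converge in measure converge almost everywhere along a common
subsequence. -/
theorem exists_common_seq_tendsto_ae {f : ℕ → ℕ → Ω → ℝ} {g : ℕ → Ω → ℝ}
    (h : ∀ i, TendstoInMeasure P (f i) atTop (g i)) :
    ∃ φ : ℕ → ℕ, StrictMono φ ∧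
      ∀ᵐ ω ∂P, ∀ i, Tendsto (fun n => f i (φ n) ω) atTop (𝓝 (g i ω)) := by
  set c : ℕ → ℝ≥0∞ := fun n => 2⁻¹ ^ n with hc
  have hc0 : ∀ n, 0 < c n := fun n => ENNReal.pow_pos (by simp) n
  have hclim : Tendsto c atTop (𝓝 0) :=
    ENNReal.tendsto_pow_atTop_nhds_zero_of_lt_one (by simp)
  -- Diagonal choice: `φ n` controls the sequences with index at most `n` at level `2⁻ⁿ`. For fixed
  -- `i` this is available from `n = i` on, hence the shift by `i` before Borel–Cantelli.
  obtain ⟨φ, hφ, hφP⟩ := extraction_forall_of_eventually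
    (P := fun n k => ∀ i ≤ n, P {ω | c n ≤ edist (f i k ω) (g i ω)} ≤ c n) (fun n => by
      have : ∀ i ∈ Set.Iic n, ∀ᶠ k in atTop, P {ω | c n ≤ edist (f i k ω) (g i ω)} ≤ c n :=
        fun i _ => (h i (c n) (hc0 n)).eventually_le_const (hc0 n)
      exact (eventually_all_finite (Set.finite_Iic n)).2 this)
  refine ⟨φ, hφ, ae_all_iff.2 fun i => ?_⟩
  have hsum : ∑' n, P {ω | c (n + i) ≤ edist (f i (φ (n + i)) ω) (g i ω)} ≠ ∞ := by
    refine ne_top_of_le_ne_top (b := ∑' n, c n) ?_ (ENNReal.tsum_le_tsum fun n => ?_)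
    · rw [hc, ENNReal.tsum_geometric]
      simp
    · refine (hφP (n + i) i (Nat.le_add_left i n)).trans ?_
      exact pow_le_pow_right_of_le_one' (by simp) (Nat.le_add_right n i)
  filter_upwards [ae_eventually_notMem hsum] with ω hω
  rw [← tendsto_add_atTop_iff_nat i, tendsto_iff_edist_tendsto_0]
  refine tendsto_of_tendsto_of_tendsto_of_le_of_le' tendsto_const_nhds
    ((tendsto_add_atTop_iff_nat i).2 hclim) (Eventually.of_forall fun _ => zero_le) ?_
  filter_upwards [hω] with n hn
  exact (not_le.1 hn).le

/-- There is a sequence of points of `[0,T]` such that convergence of non-decreasing functions at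
these points to a continuous function implies convergence at every point of `[0,T]`. -/
theorem exists_seq_forall_tendsto_of_monotone {T : ℝ} (hT : 0 ≤ T) :
    ∃ d : ℕ → ℝ, (∀ i, d i ∈ Set.Icc 0 T) ∧ ∀ (F : ℕ → ℝ → ℝ) (Q : ℝ → ℝ),
      (∀ n, Monotone (F n)) → ContinuousOn Q (Set.Icc 0 T) →
      (∀ i, Tendsto (fun n => F n (d i)) atTop (𝓝 (Q (d i)))) →
      ∀ t ∈ Set.Icc 0 T, Tendsto (fun n => F n t) atTop (𝓝 (Q t)) := by
  set a := TopologicalSpace.denseSeq ℝ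
  have ha : DenseRange a := TopologicalSpace.denseRange_denseSeq ℝ
  -- Clamping a dense sequence of `ℝ` makes it hit `0` and `T` exactly, so that each `t`, endpoints
  -- included, is squeezed between two nearby sample points.
  refine ⟨fun i => max 0 (min T (a i)),
    fun i => ⟨le_max_left _ _, max_le hT (min_le_left _ _)⟩, fun F Q hF hQ hd t ht => ?_⟩
  rw [Metric.tendsto_atTop]
  intro ε hε
  obtain ⟨δ, hδ, hQδ⟩ := Metric.continuousOn_iff.1 hQ t ht (ε / 2) (by positivity)
  obtain ⟨i, hi⟩ := ha.exists_mem_open isOpen_Ioo (Set.nonempty_Ioo.2 (by linarith : t - δ < t))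
  obtain ⟨j, hj⟩ := ha.exists_mem_open isOpen_Ioo (Set.nonempty_Ioo.2 (by linarith : t < t + δ))
  set x := max 0 (min T (a i)) with hx
  set y := max 0 (min T (a j)) with hy
  have hxt : x ≤ t := max_le ht.1 ((min_le_right _ _).trans hi.2.le)
  have hxt' : t - δ < x := by
    refine lt_of_lt_of_le ?_ (le_max_right _ _)
    exact lt_min (by linarith [ht.2]) hi.1
  have hyt : t ≤ y := le_max_of_le_right (le_min ht.2 hj.1.le)
  have hyt' : y < t + δ :=
    max_lt (by linarith [ht.1]) ((min_le_right _ _).trans_lt hj.2)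
  have hxm : x ∈ Set.Icc 0 T := ⟨le_max_left _ _, hxt.trans ht.2⟩
  have hym : y ∈ Set.Icc 0 T := ⟨le_max_left _ _, max_le hT (min_le_left _ _)⟩
  have hQx := hQδ x hxm (by rw [Real.dist_eq, abs_lt]; constructor <;> linarith)
  have hQy := hQδ y hym (by rw [Real.dist_eq, abs_lt]; constructor <;> linarith)
  rw [Real.dist_eq, abs_lt] at hQx hQy
  obtain ⟨N₁, hN₁⟩ := Metric.tendsto_atTop.1 (hd i) (ε / 2) (by positivity)
  obtain ⟨N₂, hN₂⟩ := Metric.tendsto_atTop.1 (hd j) (ε / 2) (by positivity)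
  refine ⟨max N₁ N₂, fun n hn => ?_⟩
  have h1 := hN₁ n ((le_max_left _ _).trans hn)
  have h2 := hN₂ n ((le_max_right _ _).trans hn)
  rw [Real.dist_eq, abs_lt] at h1 h2
  have h3 := hF n hxt
  have h4 := hF n hyt
  rw [Real.dist_eq, abs_lt]
  constructor <;> linarith

end Convergence

theorem integral_sub_mul_sub {α : Type*} [MeasurableSpace α] {μ : Measure α} {f g h k : α → ℝ}
    (hf : MemLp f 2 μ) (hg : MemLp g 2 μ) (hh : MemLp h 2 μ) (hk : MemLp k 2 μ) :
    ∫ x, (f x - g x) * (h x - k x) ∂μ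
      = (∫ x, f x * h x ∂μ) - (∫ x, f x * k x ∂μ) - (∫ x, g x * h x ∂μ) + ∫ x, g x * k x ∂μ := by
  have hi : ∀ {F G : α → ℝ}, MemLp F 2 μ → MemLp G 2 μ → Integrable (fun x => F x * G x) μ :=
    fun hF hG => hF.integrable_mul hG
  have i1 : Integrable (fun x => f x * h x - f x * k x) μ := (hi hf hh).sub (hi hf hk)
  have i2 : Integrable (fun x => f x * h x - f x * k x - g x * h x) μ := i1.sub (hi hg hh)
  rw [← integral_sub (hi hf hh) (hi hf hk), ← integral_sub i1 (hi hg hh),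
    ← integral_add i2 (hi hg hk)]
  congr 1; funext x; ring

theorem sumSq_eq_sum_filter {Ω : Type*} {T : ℝ} {X : ℝ → Ω → ℝ} (π : IntervalPartition T)
    (t : ℝ) (ω : Ω) :
    sumSq X π t ω = ∑ k ∈ Finset.univ.filter (fun k : Fin π.size => π.pt k.succ ≤ t),
      (X (π.pt k.succ) ω - X (π.pt k.castSucc) ω) ^ 2 := by
  rw [Finset.sum_filter, sumSq]

theorem sumSq_monotone {Ω : Type*} {T : ℝ} (X : ℝ → Ω → ℝ) (π : IntervalPartition T) (ω : Ω) :
    Monotone fun t => sumSq X π t ω := by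
  intro s t hst
  refine Finset.sum_le_sum fun k _ => ?_
  split_ifs with h1 h2 h2
  · exact le_rfl
  · exact absurd (h1.trans hst) h2
  · positivity
  · exact le_rfl

/-! ### From the kernel to the process -/

namespace IsRegularInvertibleGaussianVolterra

variable {Ω : Type*} [MeasurableSpace Ω] {P : Measure Ω} {T : ℝ} {X : ℝ → Ω → ℝ}
  {m : StieltjesFunction ℝ} {K : ℝ → ℝ → ℝ}

theorem hasGaussianLaw_increments (hX : IsRegularInvertibleGaussianVolterra P T X m K)
    (π : IntervalPartition T) :
    HasGaussianLaw (fun ω (k : Fin π.size) => X (π.pt k.succ) ω - X (π.pt k.castSucc) ω) P :=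
  hX.gaussian.hasGaussianLaw_increments (t := fun k => ⟨π.pt k, π.pt_mem k⟩)

theorem memLp_two (hX : IsRegularInvertibleGaussianVolterra P T X m K) {t : ℝ}
    (ht : t ∈ Set.Icc 0 T) : MemLp (X t) 2 P :=
  (hX.gaussian.hasGaussianLaw_eval ⟨t, ht⟩).memLp_two

/-- Beyond `t ∧ s` one factor vanishes by the Volterra property, so the cutoff can be dropped.
Covariances become `L²(dm)` inner products, and increments of `X` correspond to increments of `K`.
-/
theorem integral_mul (hT : 0 < T) (hX : IsRegularInvertibleGaussianVolterra P T X m K) {s t : ℝ}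
    (ht : t ∈ Set.Icc 0 T) (hs : s ∈ Set.Icc 0 T) :
    ∫ ω, X t ω * X s ω ∂P = ∫ u, K t u * K s u ∂(clock T m) := by
  have hc := hX.pair.clock_continuous
  rw [hX.covariance t ht s hs, setIntegral_Ioc_eq_clock
    ⟨le_min ht.1 hs.1, (min_le_left _ _).trans ht.2⟩ hc]
  refine integral_congr_ae ?_
  filter_upwards [ae_clock_mem_Ioo hT hc, ae_clock_ne hc ht, ae_clock_ne hc hs] with u hu hut hus
  have huI := Set.Ioo_subset_Icc_self hu
  split_ifs with h
  · rfl
  · rw [lt_min_iff, not_and_or, not_lt, not_lt] at h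
    rcases h with h | h
    · rw [hX.pair.volterra u huI t ht (lt_of_le_of_ne h hut.symm), zero_mul]
    · rw [hX.pair.volterra u huI s hs (lt_of_le_of_ne h hus.symm), mul_zero]

theorem integral_increment_mul (hT : 0 < T) (hX : IsRegularInvertibleGaussianVolterra P T X m K)
    {a b c d : ℝ} (ha : a ∈ Set.Icc 0 T) (hb : b ∈ Set.Icc 0 T) (hc : c ∈ Set.Icc 0 T)
    (hd : d ∈ Set.Icc 0 T) :
    ∫ ω, (X a ω - X b ω) * (X c ω - X d ω) ∂P
      = ∫ u, (K a u - K b u) * (K c u - K d u) ∂(clock T m) := by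
  rw [integral_sub_mul_sub (hX.memLp_two ha) (hX.memLp_two hb) (hX.memLp_two hc)
      (hX.memLp_two hd),
    integral_sub_mul_sub (hX.memLp_section a ha) (hX.memLp_section b hb) (hX.memLp_section c hc)
      (hX.memLp_section d hd), hX.integral_mul hT ha hc, hX.integral_mul hT ha hd,
    hX.integral_mul hT hb hc, hX.integral_mul hT hb hd]

theorem integral_increment_sq (hT : 0 < T) (hX : IsRegularInvertibleGaussianVolterra P T X m K)
    {a b : ℝ} (ha : a ∈ Set.Icc 0 T) (hb : b ∈ Set.Icc 0 T) :
    ∫ ω, (X a ω - X b ω) ^ 2 ∂P = ∫ u, (K a u - K b u) ^ 2 ∂(clock T m) := by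
  simp_rw [sq]
  exact hX.integral_increment_mul hT ha hb ha hb

theorem integral_increment (hX : IsRegularInvertibleGaussianVolterra P T X m K) {a b : ℝ}
    (ha : a ∈ Set.Icc 0 T) (hb : b ∈ Set.Icc 0 T) : ∫ ω, (X a ω - X b ω) ∂P = 0 := by
  rw [integral_sub (hX.gaussian.hasGaussianLaw_eval ⟨a, ha⟩).integrable
    (hX.gaussian.hasGaussianLaw_eval ⟨b, hb⟩).integrable, hX.centered a ha, hX.centered b hb,
    sub_zero]

theorem integral_increment_mul_nonneg (hT : 0 < T)
    (hX : IsRegularInvertibleGaussianVolterra P T X m K) (π : IntervalPartition T)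
    (j k : Fin π.size) :
    0 ≤ ∫ ω, (X (π.pt j.succ) ω - X (π.pt j.castSucc) ω)
      * (X (π.pt k.succ) ω - X (π.pt k.castSucc) ω) ∂P := by
  rw [hX.integral_increment_mul hT (π.pt_mem _) (π.pt_mem _) (π.pt_mem _) (π.pt_mem _)]
  refine integral_nonneg_of_ae ?_
  filter_upwards [ae_clock_mem_Ioo hT hX.pair.clock_continuous] with u hu
  exact mul_nonneg (π.increment_nonneg (hX.pair.monotone u hu) j)
    (π.increment_nonneg (hX.pair.monotone u hu) k)

/-- Pointwise `(b - a)² ≤ b² - a²` for `0 ≤ a ≤ b`, applied to values of the kernel. -/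
theorem integral_increment_sq_le (hT : 0 < T)
    (hX : IsRegularInvertibleGaussianVolterra P T X m K) {a b : ℝ} (ha : a ∈ Set.Icc 0 T)
    (hb : b ∈ Set.Icc 0 T) (hab : a ≤ b) :
    ∫ ω, (X b ω - X a ω) ^ 2 ∂P
      ≤ (∫ u, K b u ^ 2 ∂(clock T m)) - ∫ u, K a u ^ 2 ∂(clock T m) := by
  have hLa := hX.memLp_section a ha
  have hLb := hX.memLp_section b hb
  rw [hX.integral_increment_sq hT hb ha, ← integral_sub hLb.integrable_sq hLa.integrable_sq]
  refine integral_mono_ae (hLb.sub hLa).integrable_sq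
    (hLb.integrable_sq.sub hLa.integrable_sq) ?_
  filter_upwards [ae_clock_mem_Ioo hT hX.pair.clock_continuous] with u hu
  have h1 := hX.pair.nonneg hu ha
  have h2 := hX.pair.monotone u hu ha hb hab
  simp only at h2 ⊢
  nlinarith

theorem integral_increment_mul_le (hX : IsRegularInvertibleGaussianVolterra P T X m K)
    (π : IntervalPartition T) {ε : ℝ}
    (hε : ∀ k : Fin π.size, ∫ ω, (X (π.pt k.succ) ω - X (π.pt k.castSucc) ω) ^ 2 ∂P ≤ ε)
    (j k : Fin π.size) :
    ∫ ω, (X (π.pt j.succ) ω - X (π.pt j.castSucc) ω)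
      * (X (π.pt k.succ) ω - X (π.pt k.castSucc) ω) ∂P ≤ ε := by
  have hL : ∀ k : Fin π.size,
      MemLp (fun ω => X (π.pt k.succ) ω - X (π.pt k.castSucc) ω) 2 P := fun k =>
    (hX.memLp_two (π.pt_mem _)).sub (hX.memLp_two (π.pt_mem _))
  have hi : Integrable (fun ω => (X (π.pt j.succ) ω - X (π.pt j.castSucc) ω)
      * (X (π.pt k.succ) ω - X (π.pt k.castSucc) ω)) P := (hL j).integrable_mul (hL k)
  have h : ∫ ω, (X (π.pt j.succ) ω - X (π.pt j.castSucc) ω)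
      * (X (π.pt k.succ) ω - X (π.pt k.castSucc) ω) ∂P
      ≤ ∫ ω, ((X (π.pt j.succ) ω - X (π.pt j.castSucc) ω) ^ 2 * (1 / 2)
        + (X (π.pt k.succ) ω - X (π.pt k.castSucc) ω) ^ 2 * (1 / 2)) ∂P := by
    refine integral_mono hi
      (((hL j).integrable_sq.mul_const _).add ((hL k).integrable_sq.mul_const _)) fun ω => ?_
    -- This is `xy ≤ (x² + y²)/2`: bounds on the variances control the covariances.
    nlinarith [sq_nonneg ((X (π.pt j.succ) ω - X (π.pt j.castSucc) ω)
      - (X (π.pt k.succ) ω - X (π.pt k.castSucc) ω))]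
  rw [integral_add ((hL j).integrable_sq.mul_const _) ((hL k).integrable_sq.mul_const _),
    integral_mul_const, integral_mul_const] at h
  linarith [hε j, hε k]

theorem memLp_sumSq (hX : IsRegularInvertibleGaussianVolterra P T X m K)
    (π : IntervalPartition T) (t : ℝ) : MemLp (sumSq X π t) 2 P := by
  refine (memLp_finsetSum (Finset.univ.filter (fun k : Fin π.size => π.pt k.succ ≤ t))
    fun k _ => memLp_two_sq_of_hasGaussianLaw ((hX.hasGaussianLaw_increments π).eval k)).ae_eq ?_
  exact ae_of_all _ fun ω => (sumSq_eq_sum_filter π t ω).symm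

theorem integral_sumSq_eq_sum (hX : IsRegularInvertibleGaussianVolterra P T X m K)
    (π : IntervalPartition T) (t : ℝ) :
    ∫ ω, sumSq X π t ω ∂P
      = ∑ k ∈ Finset.univ.filter (fun k : Fin π.size => π.pt k.succ ≤ t),
        ∫ ω, (X (π.pt k.succ) ω - X (π.pt k.castSucc) ω) ^ 2 ∂P := by
  simp_rw [sumSq_eq_sum_filter]
  exact integral_finsetSum _ fun k _ =>
    ((hX.memLp_two (π.pt_mem _)).sub (hX.memLp_two (π.pt_mem _))).integrable_sq

theorem integral_sumSq (hT : 0 < T) (hX : IsRegularInvertibleGaussianVolterra P T X m K)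
    (π : IntervalPartition T) (t : ℝ) :
    ∫ ω, sumSq X π t ω ∂P = ∫ u, sumSq K π t u ∂(clock T m) := by
  rw [hX.integral_sumSq_eq_sum]
  simp_rw [sumSq_eq_sum_filter]
  have hi : ∀ k : Fin π.size,
      Integrable (fun u => (K (π.pt k.succ) u - K (π.pt k.castSucc) u) ^ 2) (clock T m) := fun k =>
    ((hX.memLp_section _ (π.pt_mem _)).sub (hX.memLp_section _ (π.pt_mem _))).integrable_sq
  rw [integral_finsetSum _ fun k _ => hi k]
  exact Finset.sum_congr rfl fun k _ => hX.integral_increment_sq hT (π.pt_mem _) (π.pt_mem _)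

theorem tendsto_variance_sumSq (hT : 0 < T) (hX : IsRegularInvertibleGaussianVolterra P T X m K)
    {π : ℕ → IntervalPartition T} (hπ : Tendsto (fun n => (π n).mesh) atTop (𝓝 0)) (t : ℝ) :
    Tendsto (fun n => ∫ ω, (sumSq X (π n) t ω - ∫ ω', sumSq X (π n) t ω' ∂P) ^ 2 ∂P) atTop
      (𝓝 0) := by
  have hTI : T ∈ Set.Icc 0 T := ⟨hT.le, le_rfl⟩
  set C := ∫ ω, (X T ω - X 0 ω) ^ 2 ∂P with hC
  have hC0 : 0 ≤ C := integral_nonneg fun _ => sq_nonneg _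
  have huc := isCompact_Icc.uniformContinuousOn_of_continuous
    (hX.pair.continuousOn_integral_sq hT hX.memLp_section)
  rw [Metric.uniformContinuousOn_iff] at huc
  rw [Metric.tendsto_atTop]
  intro ε hε
  -- The variance bound will be `2 η C`; the extra `1` covers `C = 0` and makes the final inequality
  -- strict.
  obtain ⟨δ, hδ, hG⟩ := huc (ε / (2 * C + 1)) (by positivity)
  obtain ⟨N, hN⟩ := eventually_atTop.1 (hπ.eventually_lt_const hδ)
  refine ⟨N, fun n hn => ?_⟩
  set p := π n
  set η := ε / (2 * C + 1) with hη
  have hη0 : 0 < η := by positivity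
  have hvar : ∀ k : Fin p.size,
      ∫ ω, (X (p.pt k.succ) ω - X (p.pt k.castSucc) ω) ^ 2 ∂P ≤ η := by
    intro k
    have h1 := hG _ (p.pt_mem k.succ) _ (p.pt_mem k.castSucc) (by
      rw [Real.dist_eq, abs_of_nonneg (sub_nonneg.2 (p.pt_castSucc_le_succ k))]
      exact (p.sub_le_mesh k).trans_lt (hN n hn))
    rw [Real.dist_eq] at h1
    exact (hX.integral_increment_sq_le hT (p.pt_mem _) (p.pt_mem _)
      (p.pt_castSucc_le_succ k)).trans ((le_abs_self _).trans h1.le)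
  have hmain := integral_sq_sum_sq_sub_le (hX.hasGaussianLaw_increments p)
    (fun k => hX.integral_increment (p.pt_mem _) (p.pt_mem _))
    (hX.integral_increment_mul_nonneg hT p) (hX.integral_increment_mul_le p hvar)
    (Finset.univ.filter (fun k : Fin p.size => p.pt k.succ ≤ t))
  rw [← hX.integral_sumSq_eq_sum] at hmain
  simp_rw [← sumSq_eq_sum_filter, fun ω => p.sum_increments fun s => X s ω] at hmain
  rw [Real.dist_eq, sub_zero, abs_of_nonneg (integral_nonneg fun _ => sq_nonneg _)]
  calc _ ≤ 2 * η * C := hmain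
    _ < η * (2 * C + 1) := by linarith
    _ = ε := by rw [hη, div_mul_cancel₀]; positivity

theorem tendsto_eLpNorm_two (hT : 0 < T) [IsProbabilityMeasure P]
    (hX : IsRegularInvertibleGaussianVolterra P T X m K)
    {π : ℕ → IntervalPartition T} (hπ : Tendsto (fun n => (π n).mesh) atTop (𝓝 0)) {t : ℝ}
    (ht : t ∈ Set.Icc 0 T) :
    Tendsto (fun n => eLpNorm (fun ω => sumSq X (π n) t ω
      - ∫ s in Set.Ioc 0 t, K s s ^ 2 ∂m.measure) 2 P) atTop (𝓝 0) := by
  set q := ∫ s in Set.Ioc 0 t, K s s ^ 2 ∂m.measure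
  have hmean : Tendsto (fun n => ∫ ω, sumSq X (π n) t ω ∂P) atTop (𝓝 q) := by
    simp_rw [hX.integral_sumSq hT]
    exact hX.pair.tendsto_integral_sumSq hT hX.memLp_section hπ ht
  have hsq : Tendsto (fun n => ∫ ω, (sumSq X (π n) t ω - q) ^ 2 ∂P) atTop (𝓝 0) := by
    -- The mean square error is the variance plus the squared bias; the cross term integrates to
    -- zero.
    have h1 : Tendsto (fun n => (∫ ω, (sumSq X (π n) t ω - ∫ ω', sumSq X (π n) t ω' ∂P) ^ 2 ∂P)
        + ((∫ ω, sumSq X (π n) t ω ∂P) - q) ^ 2) atTop (𝓝 0) := by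
      simpa using (hX.tendsto_variance_sumSq hT hπ t).add ((hmean.sub_const q).pow 2)
    refine h1.congr fun n => ?_
    set a := ∫ ω, sumSq X (π n) t ω ∂P with ha
    have hL : MemLp (fun ω => sumSq X (π n) t ω - a) 2 P :=
      (hX.memLp_sumSq (π n) t).sub (memLp_const a)
    have hi : Integrable (fun ω => sumSq X (π n) t ω - a) P := hL.integrable (by norm_num)
    have hz : ∫ ω, (sumSq X (π n) t ω - a) ∂P = 0 := by
      rw [integral_sub ((hX.memLp_sumSq (π n) t).integrable (by norm_num)) (integrable_const a)]
      simp [ha]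
    have hr : ∀ ω, (sumSq X (π n) t ω - q) ^ 2
        = (sumSq X (π n) t ω - a) ^ 2
          + (2 * (a - q) * (sumSq X (π n) t ω - a) + (a - q) ^ 2) := fun ω => by ring
    have hj : Integrable (fun ω => 2 * (a - q) * (sumSq X (π n) t ω - a) + (a - q) ^ 2) P :=
      (hi.const_mul _).add (integrable_const _)
    simp_rw [hr]
    rw [integral_add hL.integrable_sq hj,
      integral_add (hi.const_mul _) (integrable_const _), integral_const_mul, hz]
    simp
  have hnorm : ∀ n, eLpNorm (fun ω => sumSq X (π n) t ω - q) 2 P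
      = ENNReal.ofReal ((∫ ω, (sumSq X (π n) t ω - q) ^ 2 ∂P) ^ (2⁻¹ : ℝ)) := by
    intro n
    have hL : MemLp (fun ω => sumSq X (π n) t ω - q) 2 P :=
      (hX.memLp_sumSq (π n) t).sub (memLp_const q)
    rw [hL.eLpNorm_eq_integral_rpow_norm (by simp) (by simp)]
    simp
  simp_rw [hnorm]
  have h2 : Tendsto (fun n => (∫ ω, (sumSq X (π n) t ω - q) ^ 2 ∂P) ^ (2⁻¹ : ℝ)) atTop (𝓝 0) := by
    have := hsq.rpow_const (p := (2⁻¹ : ℝ)) (Or.inr (by norm_num))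
    rwa [Real.zero_rpow (by norm_num)] at this
  simpa using ENNReal.tendsto_ofReal h2

/-- Triangle inequality, then scaling for each squared increment: the constant does not depend on
the partition. -/
theorem eLpNorm_sumSq_le (hX : IsRegularInvertibleGaussianVolterra P T X m K)
    [IsProbabilityMeasure P] (π : IntervalPartition T) (t : ℝ) {p : ℝ≥0∞} (hp : 1 ≤ p) :
    eLpNorm (sumSq X π t) p P ≤ ENNReal.ofReal (∫ ω, sumSq X π t ω ∂P)
      * eLpNorm (fun x : ℝ => x ^ 2) p (gaussianReal 0 1) := by
  have hg := fun k => (hX.hasGaussianLaw_increments π).eval k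
  have hV : sumSq X π t = ∑ k ∈ Finset.univ.filter (fun k : Fin π.size => π.pt k.succ ≤ t),
      fun ω => (X (π.pt k.succ) ω - X (π.pt k.castSucc) ω) ^ 2 := by
    funext ω
    rw [sumSq_eq_sum_filter, Finset.sum_apply]
  rw [hX.integral_sumSq_eq_sum, ENNReal.ofReal_sum_of_nonneg
    (fun k _ => integral_nonneg fun _ => sq_nonneg _), Finset.sum_mul, hV]
  refine (eLpNorm_sum_le (fun k _ => ((hg k).aemeasurable.pow_const 2).aestronglyMeasurable)
    hp).trans (Finset.sum_le_sum fun k _ => ?_)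
  exact (eLpNorm_sq_of_hasGaussianLaw (hg k)
    (hX.integral_increment (π.pt_mem _) (π.pt_mem _)) p).le

theorem tendsto_eLpNorm (hT : 0 < T) [IsProbabilityMeasure P]
    (hX : IsRegularInvertibleGaussianVolterra P T X m K)
    {π : ℕ → IntervalPartition T} (hπ : Tendsto (fun n => (π n).mesh) atTop (𝓝 0)) {t : ℝ}
    (ht : t ∈ Set.Icc 0 T) {p : ℝ≥0∞} (hp1 : 1 ≤ p) (hp : p ≠ ∞) :
    Tendsto (fun n => eLpNorm (fun ω => sumSq X (π n) t ω
      - ∫ s in Set.Ioc 0 t, K s s ^ 2 ∂m.measure) p P) atTop (𝓝 0) := by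
  refine tendsto_eLpNorm_zero_of_bounded
    (fun n => (hX.memLp_sumSq (π n) t).1.sub aestronglyMeasurable_const)
    (hX.tendsto_eLpNorm_two hT hπ ht) (fun r hr1 hr => ?_) hp1 hp
  set q := ∫ s in Set.Ioc 0 t, K s s ^ 2 ∂m.measure
  set c := eLpNorm (fun x : ℝ => x ^ 2) r (gaussianReal 0 1)
  have hc : c ≠ ∞ := eLpNorm_sq_gaussianReal_ne_top hr
  have hmean : Tendsto (fun n => ∫ ω, sumSq X (π n) t ω ∂P) atTop (𝓝 q) := by
    simp_rw [hX.integral_sumSq hT]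
    exact hX.pair.tendsto_integral_sumSq hT hX.memLp_section hπ ht
  -- The means converge to `q`, so they are eventually at most `q + 1`; the second summand accounts
  -- for the subtracted limit.
  refine ⟨ENNReal.ofReal (q + 1) * c + eLpNorm (fun _ : Ω => q) r P,
    ENNReal.add_ne_top.2 ⟨ENNReal.mul_ne_top ENNReal.ofReal_ne_top hc, (memLp_const q).2.ne⟩, ?_⟩
  filter_upwards [hmean.eventually_le_const (lt_add_one q)] with n hn
  refine (eLpNorm_sub_le (hX.memLp_sumSq (π n) t).1 aestronglyMeasurable_const hr1).trans ?_
  gcongr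
  exact (hX.eLpNorm_sumSq_le (π n) t hr1).trans (by gcongr)

theorem hasQuadraticVariation (hT : 0 < T) [IsProbabilityMeasure P]
    (hX : IsRegularInvertibleGaussianVolterra P T X m K) :
    HasQuadraticVariation P T X (fun t _ => ∫ s in Set.Ioc 0 t, K s s ^ 2 ∂m.measure) := by
  intro π hπ
  have hmeas : ∀ t ∈ Set.Icc 0 T, TendstoInMeasure P (fun n => sumSq X (π n) t) atTop
      (fun _ => ∫ s in Set.Ioc 0 t, K s s ^ 2 ∂m.measure) := fun t ht =>
    tendstoInMeasure_of_tendsto_eLpNorm (p := 2) (by simp)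
      (fun n => (hX.memLp_sumSq (π n) t).1) aestronglyMeasurable_const
      (hX.tendsto_eLpNorm_two hT hπ ht)
  refine ⟨hmeas, ?_⟩
  obtain ⟨d, hd, hdF⟩ := exists_seq_forall_tendsto_of_monotone hT.le
  obtain ⟨φ, hφ, hae⟩ := exists_common_seq_tendsto_ae fun i => hmeas (d i) (hd i)
  refine ⟨φ, hφ, ?_⟩
  filter_upwards [hae] with ω hω t ht
  exact hdF (fun n t => sumSq X (π (φ n)) t ω) _ (fun n => sumSq_monotone X _ ω)
    (hX.pair.continuousOn_quadraticVariation hT (hX.memLp_section T ⟨hT.le, le_rfl⟩)) hω t ht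

end IsRegularInvertibleGaussianVolterra

end Volterra

theorem lemma3p1 {Ω : Type*} [MeasurableSpace Ω] (P : Measure Ω) [IsProbabilityMeasure P]
    (T : ℝ) (hT : 0 < T) (X : ℝ → Ω → ℝ) (m : StieltjesFunction ℝ) (K : ℝ → ℝ → ℝ)
    (hX : Volterra.IsRegularInvertibleGaussianVolterra P T X m K) :
    IntegrableOn (fun s => K s s ^ 2) (Set.Ioc 0 T) m.measure ∧
    Volterra.HasQuadraticVariation P T X
      (fun t _ => ∫ s in Set.Ioc 0 t, K s s ^ 2 ∂m.measure) ∧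
    (∀ π : ℕ → Volterra.IntervalPartition T,
      Tendsto (fun n => (π n).mesh) atTop (𝓝 0) →
      ∀ t ∈ Set.Icc 0 T, ∀ p : ℝ≥0∞, 1 ≤ p → p ≠ ⊤ →
        Tendsto (fun n => eLpNorm (fun ω => Volterra.sumSq X (π n) t ω
          - ∫ s in Set.Ioc 0 t, K s s ^ 2 ∂m.measure) p P) atTop (𝓝 0)) :=
  ⟨hX.pair.integrable_diagonal_sq hT (hX.memLp_section T ⟨hT.le, le_rfl⟩),
    hX.hasQuadraticVariation hT, fun _ hπ _ ht _ hp1 hp => hX.tendsto_eLpNorm hT hπ ht hp1 hp⟩
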